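/- **Setting.** Let $E$ be a separable real Banach space and let $\boldsymbol\eta=\{\eta_k\}_{k\in\mathbb Z}$ be a stationary $E$-valued process such that $\mathcal K:=\operatorname{supp}\mathcal D(\eta_k)$ is compact. Write $\mathbb Z_-=\{0,-1,-2,\dots\}$, let $\sigma$ be the law of the past $\{\eta_k,k\in\mathbb Z_-\}$ on $E^{\mathbb Z_-}$ (with the product topology), and let $\mathcal E\subset\mathcal K^{\mathbb Z_-}$ be the support of $\sigma$. Fix $\iota>1$ and set $d(\boldsymbol\xi,\boldsymbol\xi')=\sum_{k\le0}\iota^{k}\|\xi_k-\xi_k'\|$. Let $Q(\boldsymbol\xi;\cdot)$ be a version of the conditional law of $\eta_1$ given the past $\{\eta_k,k\in\mathbb Z_-\}=\boldsymbol\xi$. Put $$\boldsymbol Q_k(\boldsymbol\xi;dy_1,\dots,dy_k)=Q(\boldsymbol\xi;dy_1)\,Q((\boldsymbol\xi,y_1);dy_2)\cdots Q((\boldsymbol\xi,y_1,\dots,y_{k-1});dy_k),$$ and let $Q_k^m(\boldsymbol\xi;\cdot)$ be the projection of $\boldsymbol Q_{k+m}(\boldsymbol\xi;\cdot)$ to the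 last $m$ components. Assume that $Q$ can be chosen so that the following hold. * **(SF)** $\boldsymbol\xi\mapsto Q(\boldsymbol\xi;\cdot)$ is continuous from $\mathcal E$ to $\mathcal P(\mathcal K)\subset\mathcal P(E)$ with the weak topology, and there is $C>0$ with $\|Q(\boldsymbol\xi;\cdot)-Q(\boldsymbol\xi';\cdot)\|_{\rm var}\le C\,d(\boldsymbol\xi,\boldsymbol\xi')$ for all $\boldsymbol\xi,\boldsymbol\xi'\in\mathcal E$. * **(DLP′)** There is an increasing sequence of finite-dimensional subspaces $F_n\subset E$ whose union is dense in $E$, and continuous linear projections $\mathsf P_n$ of $E$ onto $F_n$, with norms bounded uniformly in $n$, such that the following holds for every $n\ge 1$. There is a Lipschitz continuous function $\rho_n:\mathcal E\times E\to\mathbb R_+$ such that, for each $\boldsymbol\xi\in\mathcal E$, $$Q(\boldsymbol\xi;dy)=Q_n^\dagger(\boldsymbol\xi;dy_n^\dagger)\,\rho_n(\boldsymbol\xi,y_n^\dagger+y_n)\,\ell_n(dy_n),\qquad y_n=\mathsf P_ny,\quad y_n^\dagger=y-\mathsf P_ny,$$ where $Q_n^\dagger(\boldsymbol\xi;\cdot)$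 is the image of $Q(\boldsymbol\xi;\cdot)$ under $I-\mathsf P_n$ and $\ell_n$ is the Lebesgue measure on $F_n$. * **(SR)** For any integer $n\ge1$ and any $\delta>0$ there are a vector $(\bar\xi_1,\dots,\bar\xi_n)\in E^n$ and an integer $s\ge0$ such that $$\inf_{\boldsymbol\xi\in\mathcal E}Q_s^n\bigl(\boldsymbol\xi;B(\bar\xi_1,\delta)\times\cdots\times B(\bar\xi_n,\delta)\bigr)>0 .$$ **Proposition.** Under these assumptions, $\boldsymbol\eta$ is feebly mixing: for any integers $n,m\ge1$ and any bounded continuous functions $f:E^n\to\mathbb R$ and $g:E^m\to\mathbb R$, $$\lim_{k\to\infty}\mathbb E\bigl(f(\eta_1,\dots,\eta_n)\,g(\eta_{k+1},\dots,\eta_{k+m})\bigr)=\mathbb E f(\eta_1,\dots,\eta_n)\;\mathbb E g(\eta_1,\dots,\eta_m).$$ Moreover, the convergence is exponential: there is $\gamma>0$ such that for all such $n,m,f,g$ there is $C>0$ with $$\bigl|\mathbb E\bigl(f(\eta_1,\dots,\eta_n)\,g(\eta_{k+1},\dots,\eta_{k+m})\bigr)-\mathbb E f(\eta_1,\dots,\eta_n)\,\mathbb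 E g(\eta_1,\dots,\eta_m)\bigr|\le C e^{-\gamma k},\qquad k\ge0 .$$ -/

import Mathlib

open MeasureTheory ProbabilityTheory Filter Topology
open scoped ENNReal BoundedContinuousFunction

/-!
Conventions. A past `(…, ξ₋₁, ξ₀)` indexed by the non-positive integers is encoded as a function
`ξ : ℕ → E`, where `ξ j` is the component at time `-j`; the space of pasts carries the product
topology and the product σ-algebra. A finite vector `(y₁, …, y_k)` is a function `y : Fin k → E`,
where `y i` is the component with number `i + 1`.
-/

namespace FeebleMixing

section StationaryInput

variable {Ω E : Type*} [MeasurableSpace Ω] [MeasurableSpace E]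

/-- The process `η` is (strictly) stationary: all its time shifts have the same law on `E^ℤ`. -/
def IsStationary (P : Measure Ω) (η : ℤ → Ω → E) : Prop :=
  ∀ l : ℤ, P.map (fun ω (k : ℤ) => η (k + l) ω) = P.map (fun ω (k : ℤ) => η k ω)

/-- The past `{η_k, k ≤ 0}` of the process. -/
def past (η : ℤ → Ω → E) (ω : Ω) : ℕ → E := fun j => η (-(j : ℤ)) ω

/-- The law `σ` of the past. -/
noncomputable def pastLaw (P : Measure Ω) (η : ℤ → Ω → E) : Measure (ℕ → E) :=
  P.map (past η)

/-- The vector `(η_{k+1}, …, η_{k+m})`. -/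
def window (η : ℤ → Ω → E) (k m : ℕ) (ω : Ω) : Fin m → E :=
  fun i => η ((k : ℤ) + (i : ℤ) + 1) ω

end StationaryInput

section Concatenation

variable {E : Type*}

/-- The past `(ξ, y)` obtained by appending the new, most recent component `y` to `ξ`. -/
def append (ξ : ℕ → E) (y : E) : ℕ → E
  | 0 => y
  | j + 1 => ξ j

theorem measurable_append [MeasurableSpace E] :
    Measurable (fun p : (ℕ → E) × E => append p.1 p.2) := by
  refine measurable_pi_lambda _ fun j => ?_
  cases j with
  | zero => exact measurable_snd
  | succ j => exact (measurable_pi_apply j).comp measurable_fst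

/-- `Q_k(ξ; dy₁, …, dy_k) = Q(ξ; dy₁) Q((ξ, y₁); dy₂) ⋯ Q((ξ, y₁, …, y_{k-1}); dy_k)`,
defined through
`Q_{k+1}(ξ; dy₁, …, dy_{k+1}) = Q(ξ; dy₁) Q_k((ξ, y₁); dy₂, …, dy_{k+1})`. -/
noncomputable def futureLaw [MeasurableSpace E] (Q : Kernel (ℕ → E) E) :
    (k : ℕ) → Kernel (ℕ → E) (Fin k → E)
  | 0 => Kernel.const _ (Measure.dirac Fin.elim0)
  | k + 1 =>
    (Q.compProd ((futureLaw Q k).comap (fun p : (ℕ → E) × E => append p.1 p.2)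
      measurable_append)).map
      (fun q : E × (Fin k → E) => (Fin.cons q.1 q.2 : Fin (k + 1) → E))

theorem measurable_cons [MeasurableSpace E] (k : ℕ) :
    Measurable (fun q : E × (Fin k → E) => (Fin.cons q.1 q.2 : Fin (k + 1) → E)) := by
  refine measurable_pi_lambda _ fun i => ?_
  refine Fin.cases ?_ (fun j => ?_) i
  · exact measurable_fst
  · exact (measurable_pi_apply j).comp measurable_snd

instance isMarkovKernel_futureLaw [MeasurableSpace E] (Q : Kernel (ℕ → E) E)
    [IsMarkovKernel Q] (k : ℕ) : IsMarkovKernel (futureLaw Q k) := by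
  induction k with
  | zero => unfold futureLaw; infer_instance
  | succ k ih =>
    unfold futureLaw
    exact Kernel.IsMarkovKernel.map _ (measurable_cons k)

/-- `Q_k^m(ξ; ·)`: the projection of `Q_{k+m}(ξ; ·)` to the last `m` components. -/
noncomputable def delayedLaw [MeasurableSpace E] (Q : Kernel (ℕ → E) E) (k m : ℕ) :
    Kernel (ℕ → E) (Fin m → E) :=
  (futureLaw Q (k + m)).map (fun y (i : Fin m) => y (Fin.natAdd k i))

end Concatenation

/-- Total variation distance `sup_Γ |μ(Γ) - ν(Γ)|` between two probability measures. -/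
noncomputable def tvDist {α : Type*} [MeasurableSpace α] (μ ν : Measure α) : ℝ :=
  ⨆ Γ : {s : Set α // MeasurableSet s}, |μ.real Γ - ν.real Γ|

section Hypotheses

variable {E : Type*} [NormedAddCommGroup E]

/-- The distance `d(ξ, ξ') = ∑_{k ≤ 0} ι^k ‖ξ_k - ξ'_k‖` (used on pasts with components in a
bounded set, where the series converges). -/
noncomputable def pastDist (ι : ℝ) (ξ ξ' : ℕ → E) : ℝ :=
  ∑' j : ℕ, (ι ^ j)⁻¹ * ‖ξ j - ξ' j‖

variable [MeasurableSpace E]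

/-- The set `O_δ(x₁, …, x_n) = B(x₁, δ) × ⋯ × B(x_n, δ)`. -/
def polyBall {n : ℕ} (x : Fin n → E) (δ : ℝ) : Set (Fin n → E) :=
  {y | ∀ i, y i ∈ Metric.ball (x i) δ}

/-- `ξ ↦ Q(ξ; ·)` as a map into the space of probability measures with its weak topology. -/
def asProbabilityMeasure (Q : Kernel (ℕ → E) E) [IsMarkovKernel Q] (ξ : ℕ → E) :
    ProbabilityMeasure E :=
  ⟨Q ξ, inferInstance⟩

/-- Hypothesis (SF) for the transition probability `Q`, on a set `S` of pasts, with values in the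
probability measures carried by `K`. -/
structure HypSF [BorelSpace E] (ι : ℝ) (K : Set E) (S : Set (ℕ → E)) (Q : Kernel (ℕ → E) E)
    [IsMarkovKernel Q] : Prop where
  supported : ∀ ξ ∈ S, Q ξ Kᶜ = 0
  continuousOn : ContinuousOn (asProbabilityMeasure Q) S
  lipschitz : ∃ C : ℝ, 0 < C ∧ ∀ ξ ∈ S, ∀ ξ' ∈ S, tvDist (Q ξ) (Q ξ') ≤ C * pastDist ι ξ ξ'

/-- The measure `Q_n(ξ, y†; dz) = ρ_n(ξ, y† + z) ℓ_n(dz)` on the subspace `F`, where `r` stands for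
the function `ρ_n(ξ, ·)` and `ℓ` for the Lebesgue measure on `F`. -/
noncomputable def fibreMeasure [NormedSpace ℝ E] (F : Submodule ℝ E) (ℓ : Measure F) (r : E → ℝ)
    (yd : E) : Measure F :=
  ℓ.withDensity (fun z => ENNReal.ofReal (r (yd + (z : E))))

/-- Hypothesis (DLP′) for the transition probability `Q`, on a set `S` of pasts. The complementary
subspace of `F n` is the kernel of the continuous projection `p n` of `E` onto `F n`, so that
`y = p n y + (y - p n y)` is the decomposition of `y`. The Lebesgue measure on the
finite-dimensional space `F n` is a Haar measure (its normalization is immaterial). -/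
def HypDLP [NormedSpace ℝ E] (ι : ℝ) (S : Set (ℕ → E)) (Q : Kernel (ℕ → E) E) : Prop :=
  ∃ (F : ℕ → Submodule ℝ E) (p : ℕ → E →L[ℝ] E),
    Monotone F ∧
    (∀ n, FiniteDimensional ℝ (F n)) ∧
    (∀ n, LinearMap.IsProj (F n) (p n)) ∧
    Dense (⋃ n, (F n : Set E)) ∧
    (∃ M : ℝ, ∀ n, ‖p n‖ ≤ M) ∧
    ∀ n, ∃ ℓ : Measure (F n), ℓ.IsAddHaarMeasure ∧
      ∃ ρ : (ℕ → E) → E → ℝ,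
        (∀ ξ ∈ S, ∀ y, 0 ≤ ρ ξ y) ∧
        (∃ L : ℝ, ∀ ξ ∈ S, ∀ ξ' ∈ S, ∀ y y',
          |ρ ξ y - ρ ξ' y'| ≤ L * (pastDist ι ξ ξ' + ‖y - y'‖)) ∧
        ∀ ξ ∈ S, ∀ Γ : Set E, MeasurableSet Γ →
          Q ξ Γ = ∫⁻ yd, fibreMeasure (F n) ℓ (ρ ξ) yd {z | yd + (z : E) ∈ Γ}
            ∂((Q ξ).map (fun y => y - p n y))

/-- Hypothesis (SR), strong recurrence, for the transition probability `Q`, on a set `S` of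
pasts. -/
def HypSR (S : Set (ℕ → E)) (Q : Kernel (ℕ → E) E) : Prop :=
  ∀ n : ℕ, 1 ≤ n → ∀ δ : ℝ, 0 < δ → ∃ (x : Fin n → E) (s : ℕ),
    0 < ⨅ ξ ∈ S, delayedLaw Q s n ξ (polyBall x δ)

end Hypotheses

section Mixing

variable {Ω E : Type*} [MeasurableSpace Ω] [TopologicalSpace E]

/-- The correlation `𝔼 (f(η) g(θ_k η)) - 𝔼 f(η) 𝔼 g(η)`, where `h(η) = h(η₁, …, η_l)` for a
function `h` on `E^l`. -/
noncomputable def correlation (P : Measure Ω) (η : ℤ → Ω → E) {n m : ℕ}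
    (f : (Fin n → E) →ᵇ ℝ) (g : (Fin m → E) →ᵇ ℝ) (k : ℕ) : ℝ :=
  (∫ ω, f (window η 0 n ω) * g (window η k m ω) ∂P)
    - (∫ ω, f (window η 0 n ω) ∂P) * (∫ ω, g (window η 0 m ω) ∂P)

/-- Feeble mixing. -/
def FeeblyMixing (P : Measure Ω) (η : ℤ → Ω → E) : Prop :=
  ∀ n m : ℕ, 1 ≤ n → 1 ≤ m → ∀ (f : (Fin n → E) →ᵇ ℝ) (g : (Fin m → E) →ᵇ ℝ),
    Tendsto (fun k : ℕ => ∫ ω, f (window η 0 n ω) * g (window η k m ω) ∂P) atTop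
      (𝓝 ((∫ ω, f (window η 0 n ω) ∂P) * (∫ ω, g (window η 0 m ω) ∂P)))

/-- The convergence in the definition of feeble mixing holds at an exponential rate, with an
exponent that does not depend on the functions. -/
def ExponentiallyFeeblyMixing (P : Measure Ω) (η : ℤ → Ω → E) : Prop :=
  ∃ γ : ℝ, 0 < γ ∧
    ∀ n m : ℕ, 1 ≤ n → 1 ≤ m → ∀ (f : (Fin n → E) →ᵇ ℝ) (g : (Fin m → E) →ᵇ ℝ),
      ∃ C : ℝ, ∀ k : ℕ, |correlation P η f g k| ≤ C * Real.exp (-(γ * k))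

end Mixing

end FeebleMixing

/-! The process is a Markov chain on pasts, moving from `ξ` to `append ξ y` with `y ∼ Q ξ`. Let `T`
be its transition operator. Once `T^k` shrinks the oscillation of `g` exponentially on a set of full
measure, the correlation decays: by the Markov property it is a covariance with a function that is
almost constant.

No single seminorm is contracted, but the oscillation `O` and the Lipschitz constant `L` help each
other. In `LipLE.transOp`, two chains coupled maximally append the same component up to probability
`C d(ξ, ξ')`, and a common component divides the distance by `ι`; hence `L` becomes at most `ι⁻¹ L +
C O`. In `OscLE.iterate_transOp_of_recurrent`, two independent chains meet, with probability at
least `q²`, in a polyball of recent components, where their values differ by at most `ε L`; hence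
`O` becomes at most `(1 - q²) O + q² ε L`. For small `ε` and suitable `β`, the functional `O + β L`
is multiplied by some `r < 1` every `N` steps (`exists_lyapunov_contraction`).

The hypotheses concern the support of the law of the past, which the chain might leave;
`exists_isAbsorbing_subset` replaces it by a subset of full measure that the chain almost surely
never leaves. -/

namespace FeebleMixing

/-! ### Appending finite vectors to a past -/

section Concatenation

variable {E : Type*}

/-- The past obtained by appending the components `y₁, …, y_k` to `ξ`, in this order. -/
def appendMany (ξ : ℕ → E) : {k : ℕ} → (Fin k → E) → ℕ → E
  | 0, _ => ξ
  | _ + 1, y => appendMany (append ξ (y 0)) (Fin.tail y)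

theorem appendMany_cons (ξ : ℕ → E) {k : ℕ} (a : E) (y : Fin k → E) :
    appendMany ξ (Fin.cons a y : Fin (k + 1) → E) = appendMany (append ξ a) y := by
  simp [appendMany]

theorem appendMany_apply_add (ξ : ℕ → E) {k : ℕ} (y : Fin k → E) (j : ℕ) :
    appendMany ξ y (j + k) = ξ j := by
  induction k generalizing ξ j with
  | zero => rfl
  | succ k ih =>
    rw [appendMany, show j + (k + 1) = (j + 1) + k by omega, ih]
    rfl

/-- Pasts are indexed backwards in time, so the appended vector appears reversed, its last entry at
index `0`. -/
theorem appendMany_apply_lt (ξ : ℕ → E) {k : ℕ} (y : Fin k → E) (i : Fin k) :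
    appendMany ξ y (k - 1 - i) = y i := by
  induction k generalizing ξ with
  | zero => exact i.elim0
  | succ k ih =>
    rw [appendMany]
    refine Fin.cases ?_ (fun i => ?_) i
    · have h := appendMany_apply_add (append ξ (y 0)) (Fin.tail y) 0
      rw [zero_add] at h
      exact h
    · have := ih (append ξ (y 0)) (Fin.tail y) i
      rw [Fin.val_succ, show k + 1 - 1 - (i + 1 : ℕ) = k - 1 - i by omega, this]
      rfl

end Concatenation

/-! ### The transition operator and its iterates -/

section TransitionOperator

variable {E : Type*} [MeasurableSpace E]

/-- The transition operator of the Markov chain `ξ ↦ (ξ, y)`, `y ∼ Q(ξ; ·)`, on the space of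
pasts. -/
noncomputable def transOp (Q : Kernel (ℕ → E) E) (u : (ℕ → E) → ℝ) (ξ : ℕ → E) : ℝ :=
  ∫ y, u (append ξ y) ∂Q ξ

theorem measurable_append_left (ξ : ℕ → E) : Measurable (append ξ) :=
  measurable_append.comp measurable_prodMk_left

theorem integrable_of_abs_le {α : Type*} [MeasurableSpace α] {μ : Measure α} [IsFiniteMeasure μ]
    {h : α → ℝ} (hh : Measurable h) {B : ℝ} (hB : ∀ x, |h x| ≤ B) : Integrable h μ :=
  Integrable.of_bound hh.aestronglyMeasurable B (ae_of_all _ hB)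

theorem abs_integral_le_of_abs_le {α : Type*} [MeasurableSpace α] {μ : Measure α}
    [IsProbabilityMeasure μ] {h : α → ℝ} {B : ℝ} (hB : ∀ x, |h x| ≤ B) : |∫ x, h x ∂μ| ≤ B := by
  simpa using norm_integral_le_of_norm_le_const (μ := μ) (f := h) (C := B) (ae_of_all _ hB)

theorem measurable_transOp (Q : Kernel (ℕ → E) E) [IsMarkovKernel Q] {u : (ℕ → E) → ℝ}
    (hu : Measurable u) : Measurable (transOp Q u) :=
  (StronglyMeasurable.integral_kernel_prod_right' (κ := Q)
    (hu.comp measurable_append).stronglyMeasurable).measurable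

theorem abs_transOp_le (Q : Kernel (ℕ → E) E) [IsMarkovKernel Q] {u : (ℕ → E) → ℝ} {B : ℝ}
    (hB : ∀ ξ, |u ξ| ≤ B) (ξ : ℕ → E) : |transOp Q u ξ| ≤ B :=
  abs_integral_le_of_abs_le fun _ => hB _

theorem measurable_iterate_transOp (Q : Kernel (ℕ → E) E) [IsMarkovKernel Q] {u : (ℕ → E) → ℝ}
    (hu : Measurable u) (k : ℕ) : Measurable ((transOp Q)^[k] u) := by
  induction k with
  | zero => exact hu
  | succ k ih => rw [Function.iterate_succ_apply']; exact measurable_transOp Q ih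

theorem abs_iterate_transOp_le (Q : Kernel (ℕ → E) E) [IsMarkovKernel Q] {u : (ℕ → E) → ℝ} {B : ℝ}
    (hB : ∀ ξ, |u ξ| ≤ B) (k : ℕ) (ξ : ℕ → E) : |(transOp Q)^[k] u ξ| ≤ B := by
  induction k generalizing ξ with
  | zero => exact hB ξ
  | succ k ih => rw [Function.iterate_succ_apply']; exact abs_transOp_le Q ih ξ

theorem measurable_appendMany (k : ℕ) :
    Measurable (fun p : (ℕ → E) × (Fin k → E) => appendMany p.1 p.2) := by
  induction k with
  | zero => exact measurable_fst
  | succ k ih =>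
    have h : Measurable (fun p : (ℕ → E) × (Fin (k + 1) → E) =>
        (append p.1 (p.2 0), Fin.tail p.2)) := by
      have h0 : Measurable (fun p : (ℕ → E) × (Fin (k + 1) → E) => (p.1, p.2 0)) :=
        measurable_fst.prodMk ((measurable_pi_apply 0).comp measurable_snd)
      refine Measurable.prodMk (measurable_append.comp h0) ?_
      exact measurable_pi_lambda _ fun i => (measurable_pi_apply i.succ).comp measurable_snd
    exact ih.comp h

theorem measurable_appendMany_left (ξ : ℕ → E) (k : ℕ) :
    Measurable (fun y : Fin k → E => appendMany ξ y) :=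
  (measurable_appendMany k).comp measurable_prodMk_left

theorem iterate_transOp_eq_integral (Q : Kernel (ℕ → E) E) [IsMarkovKernel Q] {u : (ℕ → E) → ℝ}
    (hu : Measurable u) {B : ℝ} (hB : ∀ ξ, |u ξ| ≤ B) (k : ℕ) (ξ : ℕ → E) :
    (transOp Q)^[k] u ξ = ∫ y, u (appendMany ξ y) ∂futureLaw Q k ξ := by
  induction k generalizing ξ with
  | zero =>
    have h : Measurable (fun y : Fin 0 → E => u (appendMany ξ y)) :=
      hu.comp (measurable_appendMany_left ξ 0)
    rw [futureLaw, Kernel.const_apply, integral_dirac' _ _ h.stronglyMeasurable]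
    rfl
  | succ k ih =>
    have h : Measurable (fun y : Fin (k + 1) → E => u (appendMany ξ y)) :=
      hu.comp (measurable_appendMany_left ξ (k + 1))
    rw [Function.iterate_succ_apply', futureLaw, Kernel.map_apply _ (measurable_cons k),
      integral_map (measurable_cons k).aemeasurable h.aestronglyMeasurable]
    rw [integral_compProd (f := fun q : E × (Fin k → E) =>
      u (appendMany ξ (Fin.cons q.1 q.2 : Fin (k + 1) → E)))
      (integrable_of_abs_le (h.comp (measurable_cons k)) (B := B) fun _ => hB _)]
    refine integral_congr_ae (ae_of_all _ fun y => ?_)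
    simp only [appendMany_cons]
    rw [ih, Kernel.comap_apply]

/-- A set of pasts from which the chain `ξ ↦ (ξ, y)` almost surely never leaves. -/
def IsAbsorbing (Q : Kernel (ℕ → E) E) (S : Set (ℕ → E)) : Prop :=
  ∀ ξ ∈ S, ∀ᵐ y ∂Q ξ, append ξ y ∈ S

/-- The iterates of the operator on the indicator of `Sᶜ` vanish on `S` by induction, and each of
them is the probability of being outside `S` after `k` steps. -/
theorem IsAbsorbing.ae_appendMany_mem {Q : Kernel (ℕ → E) E} [IsMarkovKernel Q] {S : Set (ℕ → E)}
    (hS : IsAbsorbing Q S) (hm : MeasurableSet S) (k : ℕ) {ξ : ℕ → E} (hξ : ξ ∈ S) :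
    ∀ᵐ y ∂futureLaw Q k ξ, appendMany ξ y ∈ S := by
  classical
  set v : (ℕ → E) → ℝ := Sᶜ.indicator 1 with hv
  have hvm : Measurable v := measurable_one.indicator hm.compl
  have hv0 : ∀ ξ, 0 ≤ v ξ := fun ξ => Set.indicator_nonneg (fun _ _ => zero_le_one) ξ
  have hv1 : ∀ ξ, |v ξ| ≤ 1 := fun ξ => by
    rw [abs_of_nonneg (hv0 ξ)]
    exact Set.indicator_le_self' (fun _ _ => zero_le_one) ξ
  have hz : ∀ k, ∀ ξ ∈ S, (transOp Q)^[k] v ξ = 0 := by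
    intro k
    induction k with
    | zero => intro ξ hξ; simp [hv, hξ]
    | succ k ih =>
      intro ξ hξ
      rw [Function.iterate_succ_apply']
      refine integral_eq_zero_of_ae ?_
      filter_upwards [hS ξ hξ] with y hy
      exact ih _ hy
  have h := hz k ξ hξ
  have hvc := hvm.comp (measurable_appendMany_left ξ k)
  rw [iterate_transOp_eq_integral Q hvm hv1, integral_eq_zero_iff_of_nonneg (fun _ => hv0 _)
    (integrable_of_abs_le hvc (B := 1) fun _ => hv1 _)] at h
  filter_upwards [h] with y hy
  by_contra hn
  simp [hv, hn] at hy

end TransitionOperator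

/-! ### The weighted distance on pasts -/

section PastDist

variable {E : Type*} [NormedAddCommGroup E]

theorem summable_pastDist {ι D : ℝ} (hι : 1 < ι) {ξ ξ' : ℕ → E} (h : ∀ j, ‖ξ j - ξ' j‖ ≤ D) :
    Summable fun j : ℕ => (ι ^ j)⁻¹ * ‖ξ j - ξ' j‖ := by
  have hg : Summable fun j : ℕ => (ι⁻¹) ^ j * D :=
    (summable_geometric_of_lt_one (by positivity) (inv_lt_one_of_one_lt₀ hι)).mul_right D
  refine hg.of_nonneg_of_le (fun j => by positivity) fun j => ?_
  rw [inv_pow]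
  exact mul_le_mul_of_nonneg_left (h j) (by positivity)

theorem pastDist_nonneg {ι : ℝ} (hι : 1 < ι) (ξ ξ' : ℕ → E) : 0 ≤ pastDist ι ξ ξ' :=
  tsum_nonneg fun j => by positivity

/-- The common new component contributes nothing and every older one loses a factor `ι`: this is the
source of contraction for Lipschitz constants. -/
theorem pastDist_append {ι D : ℝ} (hι : 1 < ι) {ξ ξ' : ℕ → E} (h : ∀ j, ‖ξ j - ξ' j‖ ≤ D) (y : E) :
    pastDist ι (append ξ y) (append ξ' y) = ι⁻¹ * pastDist ι ξ ξ' := by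
  have hD : 0 ≤ D := (norm_nonneg _).trans (h 0)
  have hs := summable_pastDist hι (ξ := append ξ y) (ξ' := append ξ' y) (D := D) (by
    rintro (_ | j)
    · simpa [append] using hD
    · exact h j)
  rw [pastDist, hs.tsum_eq_zero_add, pastDist, ← tsum_mul_left]
  simp only [append, sub_self, norm_zero, mul_zero, zero_add]
  refine tsum_congr fun j => ?_
  rw [pow_succ, mul_inv]
  ring

theorem pastDist_le_of_close {ι D a : ℝ} (hι : 1 < ι) {ξ ξ' : ℕ → E} (h : ∀ j, ‖ξ j - ξ' j‖ ≤ D)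
    (ha : 0 ≤ a) {n : ℕ} (hn : ∀ j < n, ‖ξ j - ξ' j‖ ≤ a) :
    pastDist ι ξ ξ' ≤ (a + (ι⁻¹) ^ n * D) * (1 - ι⁻¹)⁻¹ := by
  have hr := inv_lt_one_of_one_lt₀ hι
  have hr0 : 0 ≤ ι⁻¹ := by positivity
  have hD : 0 ≤ D := (norm_nonneg _).trans (h 0)
  have hs := summable_pastDist hι h
  have hgeo := summable_geometric_of_lt_one hr0 hr
  rw [pastDist, ← hs.sum_add_tsum_nat_add n, add_mul]
  refine add_le_add ?_ ?_
  · calc ∑ i ∈ Finset.range n, (ι ^ i)⁻¹ * ‖ξ i - ξ' i‖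
        ≤ ∑ i ∈ Finset.range n, a * (ι⁻¹) ^ i := by
          refine Finset.sum_le_sum fun i hi => ?_
          rw [inv_pow, mul_comm a]
          exact mul_le_mul_of_nonneg_left (hn i (Finset.mem_range.1 hi)) (by positivity)
      _ = a * ∑ i ∈ Finset.range n, (ι⁻¹) ^ i := by rw [Finset.mul_sum]
      _ ≤ a * (1 - ι⁻¹)⁻¹ := by
          rw [← tsum_geometric_of_lt_one hr0 hr]
          exact mul_le_mul_of_nonneg_left
            (hgeo.sum_le_tsum _ fun _ _ => by positivity) ha
  · calc ∑' i, (ι ^ (i + n))⁻¹ * ‖ξ (i + n) - ξ' (i + n)‖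
        ≤ ∑' i, ((ι⁻¹) ^ n * D) * (ι⁻¹) ^ i := by
          refine ((summable_nat_add_iff n).2 hs).tsum_le_tsum (fun i => ?_) (hgeo.mul_left _)
          have := mul_le_mul_of_nonneg_left (h (i + n)) (show 0 ≤ (ι ^ (i + n))⁻¹ by positivity)
          refine this.trans_eq ?_
          rw [pow_add, mul_inv, inv_pow, inv_pow]
          ring
      _ = _ := by rw [tsum_mul_left, tsum_geometric_of_lt_one hr0 hr]

end PastDist

/-! ### Total variation and the common part of two measures -/

section TotalVariation

variable {α : Type*} [MeasurableSpace α]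

theorem abs_sub_le_tvDist (μ ν : Measure α) [IsProbabilityMeasure μ] [IsProbabilityMeasure ν]
    {Γ : Set α} (hΓ : MeasurableSet Γ) : |μ.real Γ - ν.real Γ| ≤ tvDist μ ν := by
  refine le_ciSup (f := fun Γ : {s : Set α // MeasurableSet s} => |μ.real Γ - ν.real Γ|)
    ⟨1, ?_⟩ ⟨Γ, hΓ⟩
  rintro _ ⟨Γ, rfl⟩
  have h1 : μ.real Γ ≤ 1 := measureReal_le_one
  have h2 : ν.real Γ ≤ 1 := measureReal_le_one
  have h3 : 0 ≤ μ.real Γ := measureReal_nonneg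
  have h4 : 0 ≤ ν.real Γ := measureReal_nonneg
  exact abs_le.2 ⟨by linarith, by linarith⟩

/-- The minimum of the two measures: `ν` on the Hahn set where `ν ≤ μ`, and `μ` off it. It plays the
role of a maximal coupling. -/
theorem exists_common_part (μ ν : Measure α) [IsProbabilityMeasure μ] [IsProbabilityMeasure ν] :
    ∃ κ : Measure α, κ ≤ μ ∧ κ ≤ ν ∧ 1 - tvDist μ ν ≤ κ.real Set.univ := by
  obtain ⟨s, hs, h1, h2⟩ := hahn_decomposition μ ν
  refine ⟨ν.restrict s + μ.restrict sᶜ, ?_, ?_, ?_⟩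
  · refine Measure.le_iff.2 fun t ht => ?_
    rw [Measure.add_apply, Measure.restrict_apply ht, Measure.restrict_apply ht,
      ← measure_inter_add_sdiff t hs]
    exact add_le_add (h1 _ (ht.inter hs) Set.inter_subset_right) le_rfl
  · refine Measure.le_iff.2 fun t ht => ?_
    rw [Measure.add_apply, Measure.restrict_apply ht, Measure.restrict_apply ht,
      ← measure_inter_add_sdiff t hs]
    exact add_le_add le_rfl (h2 _ (ht.inter hs.compl) Set.inter_subset_right)
  · have := (abs_le.1 (abs_sub_le_tvDist μ ν hs)).2
    rw [measureReal_add_apply, measureReal_restrict_apply_univ, measureReal_restrict_apply_univ,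
      probReal_compl_eq_one_sub hs]
    linarith

/-- Two integrals with respect to probability measures at distance `t`, of functions that are close
to each other where both are controlled. -/
theorem abs_integral_sub_integral_le {μ ν : Measure α} [IsProbabilityMeasure μ]
    [IsProbabilityMeasure ν] {h h' : α → ℝ} (hm : Measurable h) (hm' : Measurable h') {B : ℝ}
    (hB : ∀ x, |h x| ≤ B) (hB' : ∀ x, |h' x| ≤ B) {a O l : ℝ} (hO : 0 ≤ O) (hl : 0 ≤ l)
    {p p' : α → Prop} (hp : ∀ᵐ x ∂μ, p x) (hp' : ∀ᵐ x ∂ν, p' x)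
    (hab : ∀ x, p x → h x ∈ Set.Icc a (a + O)) (hab' : ∀ x, p' x → h' x ∈ Set.Icc a (a + O))
    (hl' : ∀ x, p x → p' x → |h x - h' x| ≤ l) :
    |∫ x, h x ∂μ - ∫ x, h' x ∂ν| ≤ l + O * tvDist μ ν := by
  obtain ⟨κ, hκμ, hκν, hκ⟩ := exists_common_part μ ν
  have : IsFiniteMeasure κ := ⟨(hκμ _).trans_lt (measure_lt_top _ _)⟩
  -- Split off the common part `κ`. The residual has mass `1 - κ.real univ`, and on it only the
  -- range `[a, a + O]` is known; the terms in `a` cancel between `μ` and `ν`.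
  have key : ∀ (μ : Measure α) [IsProbabilityMeasure μ] (h : α → ℝ) (p : α → Prop), κ ≤ μ →
      Measurable h → (∀ x, |h x| ≤ B) → (∀ᵐ x ∂μ, p x) →
      (∀ x, p x → h x ∈ Set.Icc a (a + O)) →
      ∫ x, h x ∂κ + a * (1 - κ.real Set.univ) ≤ ∫ x, h x ∂μ ∧
      ∫ x, h x ∂μ ≤ ∫ x, h x ∂κ + (a + O) * (1 - κ.real Set.univ) := by
    intro μ _ h p hκμ hm hB hp hab
    have hle : μ - κ ≤ μ := Measure.sub_le
    have : IsFiniteMeasure (μ - κ) := ⟨(hle _).trans_lt (measure_lt_top _ _)⟩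
    have hp2 : ∀ᵐ x ∂(μ - κ), p x := hle.absolutelyContinuous.ae_le hp
    have hsum : μ - κ + κ = μ := Measure.sub_add_cancel_of_le hκμ
    have hmass : (μ - κ).real Set.univ = 1 - κ.real Set.univ := by
      have h1 : μ.real Set.univ = 1 := probReal_univ
      rw [← hsum, measureReal_add_apply] at h1
      linarith
    have hint : ∫ x, h x ∂μ = ∫ x, h x ∂(μ - κ) + ∫ x, h x ∂κ := by
      conv_lhs => rw [← hsum]
      exact integral_add_measure (integrable_of_abs_le hm hB) (integrable_of_abs_le hm hB)
    have hc : ∀ c : ℝ, ∫ _, c ∂(μ - κ) = c * (1 - κ.real Set.univ) := fun c => by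
      rw [integral_const, smul_eq_mul, hmass, mul_comm]
    rw [hint, ← hc, ← hc]
    constructor
    · have : ∫ _, a ∂(μ - κ) ≤ ∫ x, h x ∂(μ - κ) :=
        integral_mono_ae (integrable_const _) (integrable_of_abs_le hm hB)
          (hp2.mono fun x hx => (hab x hx).1)
      linarith
    · have : ∫ x, h x ∂(μ - κ) ≤ ∫ _, a + O ∂(μ - κ) :=
        integral_mono_ae (integrable_of_abs_le hm hB) (integrable_const _)
          (hp2.mono fun x hx => (hab x hx).2)
      linarith
  have hκ1 : κ.real Set.univ ≤ 1 := by
    have h1 : μ.real Set.univ = 1 := probReal_univ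
    rw [← h1]
    exact ENNReal.toReal_mono (measure_ne_top _ _) (hκμ _)
  have hdiff : |∫ x, h x ∂κ - ∫ x, h' x ∂κ| ≤ l := by
    rw [← integral_sub (integrable_of_abs_le hm hB) (integrable_of_abs_le hm' hB')]
    have := norm_integral_le_of_norm_le_const (μ := κ) (f := fun x => h x - h' x) (C := l) (by
      filter_upwards [hκμ.absolutelyContinuous.ae_le hp,
        hκν.absolutelyContinuous.ae_le hp'] with x hx hx'
      exact hl' x hx hx')
    refine this.trans ?_
    calc l * κ.real Set.univ ≤ l * 1 := mul_le_mul_of_nonneg_left hκ1 hl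
      _ = l := mul_one l
  obtain ⟨k1, k2⟩ := key μ h p hκμ hm hB hp hab
  obtain ⟨k3, k4⟩ := key ν h' p' hκν hm' hB' hp' hab'
  have hOt : O * (1 - κ.real Set.univ) ≤ O * tvDist μ ν :=
    mul_le_mul_of_nonneg_left (by linarith) hO
  obtain ⟨d1, d2⟩ := abs_le.1 hdiff
  exact abs_le.2 ⟨by linarith, by linarith⟩

end TotalVariation

/-! ### Oscillation under the transition operator -/

section Oscillation

/-- The oscillation of `u` on `S` is at most `O`. -/
def OscLE {α : Type*} (S : Set α) (u : α → ℝ) (O : ℝ) : Prop :=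
  ∀ ξ ∈ S, ∀ ξ' ∈ S, |u ξ - u ξ'| ≤ O

theorem OscLE.mono {α : Type*} {S : Set α} {u : α → ℝ} {O O' : ℝ} (h : OscLE S u O) (hO : O ≤ O') :
    OscLE S u O' :=
  fun ξ hξ ξ' hξ' => (h ξ hξ ξ' hξ').trans hO

theorem OscLE.exists_mem_Icc {α : Type*} {S : Set α} {u : α → ℝ} {O : ℝ} (h : OscLE S u O) :
    ∃ a, ∀ ξ ∈ S, u ξ ∈ Set.Icc a (a + O) := by
  rcases S.eq_empty_or_nonempty with rfl | ⟨ξ₀, h₀⟩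
  · exact ⟨0, fun _ h => h.elim⟩
  · have hb : BddBelow (u '' S) := by
      refine ⟨u ξ₀ - O, ?_⟩
      rintro _ ⟨ξ, hξ, rfl⟩
      linarith [(abs_le.1 (h ξ₀ h₀ ξ hξ)).2]
    refine ⟨sInf (u '' S), fun ξ hξ => ⟨csInf_le hb ⟨ξ, hξ, rfl⟩, ?_⟩⟩
    have : u ξ - O ≤ sInf (u '' S) := by
      refine le_csInf ⟨_, ξ₀, h₀, rfl⟩ ?_
      rintro _ ⟨ξ', hξ', rfl⟩
      linarith [(abs_le.1 (h ξ hξ ξ' hξ')).2]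
    linarith

theorem oscLE_of_mem_Icc {α : Type*} {S : Set α} {u : α → ℝ} {a O : ℝ}
    (h : ∀ ξ ∈ S, u ξ ∈ Set.Icc a (a + O)) : OscLE S u O := by
  intro ξ hξ ξ' hξ'
  obtain ⟨h1, h2⟩ := h ξ hξ
  obtain ⟨h3, h4⟩ := h ξ' hξ'
  exact abs_le.2 ⟨by linarith, by linarith⟩

variable {E : Type*} [MeasurableSpace E] {Q : Kernel (ℕ → E) E} [IsMarkovKernel Q]
  {S : Set (ℕ → E)} {u : (ℕ → E) → ℝ} {B : ℝ}

theorem OscLE.transOp (hS : IsAbsorbing Q S) (hu : Measurable u) (hB : ∀ ξ, |u ξ| ≤ B) {O : ℝ}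
    (h : OscLE S u O) : OscLE S (transOp Q u) O := by
  obtain ⟨a, ha⟩ := h.exists_mem_Icc
  refine oscLE_of_mem_Icc (a := a) fun ξ hξ => ?_
  have hint : Integrable (fun y => u (append ξ y)) (Q ξ) :=
    integrable_of_abs_le (hu.comp (measurable_append_left ξ)) (B := B) fun _ => hB _
  constructor
  · have := integral_mono_ae (integrable_const a) hint
      ((hS ξ hξ).mono fun y hy => (ha _ hy).1)
    simpa [FeebleMixing.transOp] using this
  · have := integral_mono_ae hint (integrable_const (a + O))
      ((hS ξ hξ).mono fun y hy => (ha _ hy).2)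
    simpa [FeebleMixing.transOp] using this

theorem OscLE.iterate_transOp (hS : IsAbsorbing Q S) (hu : Measurable u) (hB : ∀ ξ, |u ξ| ≤ B)
    {O : ℝ} (h : OscLE S u O) (k : ℕ) : OscLE S ((FeebleMixing.transOp Q)^[k] u) O := by
  induction k with
  | zero => exact h
  | succ k ih =>
    rw [Function.iterate_succ_apply']
    exact ih.transOp hS (measurable_iterate_transOp Q hu k) (abs_iterate_transOp_le Q hB k)

/-- Run the two chains independently: with probability at least `q ^ 2` both future vectors lie in
`A`, where the gap is at most `e`; otherwise it is at most `O`. -/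
theorem OscLE.iterate_transOp_of_recurrent (hS : IsAbsorbing Q S) (hSm : MeasurableSet S)
    (hu : Measurable u) (hB : ∀ ξ, |u ξ| ≤ B) {O : ℝ} (h : OscLE S u O) {N : ℕ}
    {A : Set (Fin N → E)} (hA : MeasurableSet A) {q : ℝ} (hq0 : 0 ≤ q)
    (hq : ∀ ξ ∈ S, q ≤ (futureLaw Q N ξ).real A) {e : ℝ}
    (he : ∀ ξ ∈ S, ∀ ξ' ∈ S, ∀ y ∈ A, ∀ y' ∈ A, appendMany ξ y ∈ S → appendMany ξ' y' ∈ S →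
      |u (appendMany ξ y) - u (appendMany ξ' y')| ≤ e) :
    OscLE S ((FeebleMixing.transOp Q)^[N] u) ((1 - q ^ 2) * O + q ^ 2 * e) := by
  intro ξ hξ ξ' hξ'
  rw [iterate_transOp_eq_integral Q hu hB, iterate_transOp_eq_integral Q hu hB]
  set μ := futureLaw Q N ξ
  set ν := futureLaw Q N ξ'
  have hm := hu.comp (measurable_appendMany_left ξ N)
  have hm' := hu.comp (measurable_appendMany_left ξ' N)
  have hi : Integrable (fun z : (Fin N → E) × (Fin N → E) => u (appendMany ξ z.1)) (μ.prod ν) :=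
    integrable_of_abs_le (hm.comp measurable_fst) (B := B) fun _ => hB _
  have hi' : Integrable (fun z : (Fin N → E) × (Fin N → E) => u (appendMany ξ' z.2)) (μ.prod ν) :=
    integrable_of_abs_le (hm'.comp measurable_snd) (B := B) fun _ => hB _
  have heq : ∫ y, u (appendMany ξ y) ∂μ - ∫ y, u (appendMany ξ' y) ∂ν
      = ∫ z, (u (appendMany ξ z.1) - u (appendMany ξ' z.2)) ∂(μ.prod ν) := by
    rw [integral_sub hi hi', integral_fun_fst (fun y => u (appendMany ξ y)),
      integral_fun_snd (fun y => u (appendMany ξ' y))]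
    simp
  have hAA : MeasurableSet (A ×ˢ A) := hA.prod hA
  -- Since `e` may exceed `O`, the minimum keeps the gain `O - min O e` nonnegative, so that the
  -- lower bound `q ^ 2` on the probability can be used.
  have hg : Integrable (fun z => O - (A ×ˢ A).indicator (fun _ => O - min O e) z) (μ.prod ν) :=
    (integrable_const _).sub ((integrable_const _).indicator hAA)
  rw [heq]
  have hae : ∀ᵐ z ∂(μ.prod ν), ‖u (appendMany ξ z.1) - u (appendMany ξ' z.2)‖
      ≤ O - (A ×ˢ A).indicator (fun _ => O - min O e) z := by
    filter_upwards [Measure.quasiMeasurePreserving_fst.ae (hS.ae_appendMany_mem hSm N hξ),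
      Measure.quasiMeasurePreserving_snd.ae (hS.ae_appendMany_mem hSm N hξ')] with z hz hz'
    have h1 := h _ hz _ hz'
    rw [Real.norm_eq_abs]
    by_cases hzA : z ∈ A ×ˢ A
    · rw [Set.indicator_of_mem hzA]
      have := le_min h1 (he ξ hξ ξ' hξ' z.1 hzA.1 z.2 hzA.2 hz hz')
      linarith
    · rw [Set.indicator_of_notMem hzA]
      linarith
  refine (norm_integral_le_of_norm_le hg hae).trans ?_
  rw [integral_sub (integrable_const _) ((integrable_const _).indicator hAA),
    integral_indicator_const _ hAA, measureReal_prod_prod]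
  have h1 : q ^ 2 ≤ μ.real A * ν.real A := by
    rw [sq]
    exact mul_le_mul (hq ξ hξ) (hq ξ' hξ') hq0 measureReal_nonneg
  have h2 : 0 ≤ O - min O e := sub_nonneg.2 (min_le_left _ _)
  have h3 := mul_le_mul_of_nonneg_right h1 h2
  have h4 := mul_le_mul_of_nonneg_left (min_le_right O e) (sq_nonneg q)
  simp only [integral_const, probReal_univ, smul_eq_mul, one_mul]
  linarith

end Oscillation

/-! ### Lipschitz constants and the Lyapunov functional -/

section Contraction

variable {E : Type*} [NormedAddCommGroup E]

/-- `u` is `L`-Lipschitz with respect to `pastDist ι` on pairs of points of `S` whose `j` most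
recent components agree. -/
def LipLE (ι : ℝ) (S : Set (ℕ → E)) (j : ℕ) (u : (ℕ → E) → ℝ) (L : ℝ) : Prop :=
  ∀ ξ ∈ S, ∀ ξ' ∈ S, (∀ i < j, ξ i = ξ' i) → |u ξ - u ξ'| ≤ L * pastDist ι ξ ξ'

variable [MeasurableSpace E] {Q : Kernel (ℕ → E) E} [IsMarkovKernel Q] {S : Set (ℕ → E)}
  {u : (ℕ → E) → ℝ} {B : ℝ}

/-- On the common part of `Q ξ` and `Q ξ'` the same component is appended, which shrinks the
distance and lengthens the agreement by one place. The rest has mass at most `C * pastDist ι ξ ξ'`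
and costs the oscillation. -/
theorem LipLE.transOp {ι C D : ℝ} (hι : 1 < ι) (hS : IsAbsorbing Q S)
    (hD : ∀ ξ ∈ S, ∀ ξ' ∈ S, ∀ j, ‖ξ j - ξ' j‖ ≤ D)
    (hC : ∀ ξ ∈ S, ∀ ξ' ∈ S, tvDist (Q ξ) (Q ξ') ≤ C * pastDist ι ξ ξ')
    (hu : Measurable u) (hB : ∀ ξ, |u ξ| ≤ B) {O L : ℝ} (hO : 0 ≤ O) (hL : 0 ≤ L)
    (h : OscLE S u O) {j : ℕ} (hlip : LipLE ι S (j + 1) u L) :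
    LipLE ι S j (transOp Q u) (ι⁻¹ * L + C * O) := by
  intro ξ hξ ξ' hξ' hj
  obtain ⟨a, ha⟩ := h.exists_mem_Icc
  have hd := pastDist_nonneg hι ξ ξ'
  refine (abs_integral_sub_integral_le (l := L * (ι⁻¹ * pastDist ι ξ ξ'))
    (hu.comp (measurable_append_left ξ)) (hu.comp (measurable_append_left ξ'))
    (fun _ => hB _) (fun _ => hB _) hO (by positivity) (hS ξ hξ) (hS ξ' hξ')
    (fun y hy => ha _ hy) (fun y hy => ha _ hy) (fun y hy hy' => ?_)).trans ?_
  · rw [← pastDist_append hι (hD ξ hξ ξ' hξ') y]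
    refine hlip _ hy _ hy' ?_
    rintro (_ | i) hi
    · rfl
    · exact hj i (by omega)
  · have := mul_le_mul_of_nonneg_left (hC ξ hξ ξ' hξ') hO
    linarith

/-- The term in `O` is the fixed point of `c ↦ ι⁻¹ * c + C * O`. Each step removes one required
place of agreement, so an observable of finitely many components becomes Lipschitz on all of `S`. -/
theorem LipLE.iterate_transOp {ι C D : ℝ} (hι : 1 < ι) (hC0 : 0 ≤ C) (hS : IsAbsorbing Q S)
    (hD : ∀ ξ ∈ S, ∀ ξ' ∈ S, ∀ j, ‖ξ j - ξ' j‖ ≤ D)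
    (hC : ∀ ξ ∈ S, ∀ ξ' ∈ S, tvDist (Q ξ) (Q ξ') ≤ C * pastDist ι ξ ξ')
    (hu : Measurable u) (hB : ∀ ξ, |u ξ| ≤ B) {O L : ℝ} (hO : 0 ≤ O) (hL : 0 ≤ L)
    (h : OscLE S u O) {j : ℕ} (hlip : LipLE ι S j u L) (k : ℕ) :
    LipLE ι S (j - k) ((FeebleMixing.transOp Q)^[k] u)
      ((ι⁻¹) ^ k * L + C * (1 - ι⁻¹)⁻¹ * O) := by
  have hr : 0 < 1 - ι⁻¹ := sub_pos.2 (inv_lt_one_of_one_lt₀ hι)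
  induction k with
  | zero =>
    intro ξ hξ ξ' hξ' hj
    refine (hlip ξ hξ ξ' hξ' hj).trans (mul_le_mul_of_nonneg_right ?_ (pastDist_nonneg hι ξ ξ'))
    rw [pow_zero, one_mul]
    exact le_add_of_nonneg_right (by positivity)
  | succ k ih =>
    rw [Function.iterate_succ_apply']
    have hlip' : LipLE ι S (j - (k + 1) + 1) ((FeebleMixing.transOp Q)^[k] u)
        ((ι⁻¹) ^ k * L + C * (1 - ι⁻¹)⁻¹ * O) :=
      fun ξ hξ ξ' hξ' hj => ih ξ hξ ξ' hξ' fun i hi => hj i (by omega)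
    have := LipLE.transOp hι hS hD hC (measurable_iterate_transOp Q hu k)
      (abs_iterate_transOp_le Q hB k) hO (by positivity) (h.iterate_transOp hS hu hB k) hlip'
    have hw : (1 - ι⁻¹) * (1 - ι⁻¹)⁻¹ = 1 := mul_inv_cancel₀ hr.ne'
    convert this using 1
    linear_combination C * O * hw

/-- One step of the contraction: `u` is replaced by an iterate whose oscillation and Lipschitz
constant satisfy a strict inequality for the Lyapunov functional `O + β L`. -/
theorem exists_lyapunov_contraction [BorelSpace E] [SecondCountableTopology E] {ι C D : ℝ}
    (hι : 1 < ι) (hC0 : 0 < C) (hS : IsAbsorbing Q S) (hSm : MeasurableSet S) (hne : S.Nonempty)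
    (hD : ∀ ξ ∈ S, ∀ ξ' ∈ S, ∀ j, ‖ξ j - ξ' j‖ ≤ D)
    (hC : ∀ ξ ∈ S, ∀ ξ' ∈ S, tvDist (Q ξ) (Q ξ') ≤ C * pastDist ι ξ ξ') (hSR : HypSR S Q) :
    ∃ (N : ℕ) (r β : ℝ), 0 < N ∧ 0 < r ∧ r < 1 ∧ 0 ≤ β ∧
      ∀ (u : (ℕ → E) → ℝ) (B O L : ℝ), Measurable u → (∀ ξ, |u ξ| ≤ B) → 0 ≤ O → 0 ≤ L →
        OscLE S u O → LipLE ι S 0 u L →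
        ∃ O' L', 0 ≤ O' ∧ 0 ≤ L' ∧ OscLE S ((transOp Q)^[N] u) O' ∧
          LipLE ι S 0 ((transOp Q)^[N] u) L' ∧ O' + β * L' ≤ r * (O + β * L) := by
  obtain ⟨ξ₀, hξ₀⟩ := hne
  have hD0 : 0 ≤ D := (norm_nonneg _).trans (hD ξ₀ hξ₀ ξ₀ hξ₀ 0)
  have hr1 := inv_lt_one_of_one_lt₀ hι
  have hr0 : 0 < ι⁻¹ := by positivity
  have hr : 0 < 1 - ι⁻¹ := sub_pos.2 hr1
  set C' := C * (1 - ι⁻¹)⁻¹ with hC'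
  have hC'0 : 0 < C' := by positivity
  -- With `β = p ^ 2 / (2 * C')` below, `p ^ 2 * ε = β / 4` and `β * C' = p ^ 2 / 2`; then `O` gets
  -- the coefficient `1 - p ^ 2 / 2`, and `β * L` at most `1 / 4 + 1 / 2`.
  set ε := (8 * C')⁻¹ with hε
  have hε0 : 0 < ε := by positivity
  -- Balls of radius `w / 4` put recent components within `w / 2`, and the remote tail costs another
  -- `w / 2`; summing the geometric weights gives distance at most `ε`.
  set w := ε * (1 - ι⁻¹) with hw
  have hw0 : 0 < w := by positivity
  obtain ⟨n', hn'⟩ := exists_pow_lt_of_lt_one (y := ι⁻¹)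
    (show 0 < min (1 / 2) (w / (2 * (D + 1))) by positivity) hr1
  set n := n' + 1 with hn
  have hpow : (ι⁻¹) ^ n ≤ min (1 / 2) (w / (2 * (D + 1))) :=
    (pow_le_pow_of_le_one hr0.le hr1.le (Nat.le_succ n')).trans hn'.le
  have hpow1 : (ι⁻¹) ^ n ≤ 1 / 2 := hpow.trans (min_le_left _ _)
  have hpow2 : (ι⁻¹) ^ n * D ≤ w / 2 := by
    have h1 := hpow.trans (min_le_right _ _)
    calc (ι⁻¹) ^ n * D ≤ w / (2 * (D + 1)) * (D + 1) :=
          mul_le_mul h1 (by linarith) hD0 (by positivity)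
      _ = w / 2 := by field_simp
  obtain ⟨x, s, hpos⟩ := hSR n (by omega) (w / 4) (by positivity)
  set q := ⨅ ξ ∈ S, delayedLaw Q s n ξ (polyBall x (w / 4)) with hqdef
  have hpm : MeasurableSet (polyBall x (w / 4)) := by
    have : polyBall x (w / 4) = ⋂ i, (fun y : Fin n → E => y i) ⁻¹' Metric.ball (x i) (w / 4) := by
      ext y; simp [polyBall]
    rw [this]
    exact MeasurableSet.iInter fun i => measurable_pi_apply i Metric.isOpen_ball.measurableSet
  have hproj : Measurable (fun (y : Fin (s + n) → E) (i : Fin n) => y (Fin.natAdd s i)) :=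
    measurable_pi_lambda _ fun i => measurable_pi_apply _
  set A : Set (Fin (s + n) → E) :=
    (fun (y : Fin (s + n) → E) (i : Fin n) => y (Fin.natAdd s i)) ⁻¹' polyBall x (w / 4) with hAdef
  have hAm : MeasurableSet A := hproj hpm
  have hqle : ∀ ξ ∈ S, q ≤ futureLaw Q (s + n) ξ A := fun ξ hξ => by
    have : q ≤ delayedLaw Q s n ξ (polyBall x (w / 4)) := iInf₂_le ξ hξ
    rwa [delayedLaw, Kernel.map_apply _ hproj, Measure.map_apply hproj hpm] at this
  have hq1 : q ≤ 1 := (hqle ξ₀ hξ₀).trans prob_le_one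
  have hqtop : q ≠ ∞ := (hq1.trans_lt ENNReal.one_lt_top).ne
  have hp0 : 0 < q.toReal := ENNReal.toReal_pos hpos.ne' hqtop
  have hp1 : q.toReal ≤ 1 := ENNReal.toReal_mono ENNReal.one_ne_top hq1
  have hple : ∀ ξ ∈ S, q.toReal ≤ (futureLaw Q (s + n) ξ).real A := fun ξ hξ =>
    ENNReal.toReal_mono (measure_ne_top _ _) (hqle ξ hξ)
  set p := q.toReal
  have hp2 : p ^ 2 ≤ 1 := pow_le_one₀ hp0.le hp1
  have hp20 : 0 < p ^ 2 := by positivity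
  set β := p ^ 2 / (2 * C') with hβ
  have hβ0 : 0 < β := by positivity
  refine ⟨s + n, max (1 - p ^ 2 / 2) (3 / 4), β, by omega, by positivity,
    max_lt (by linarith) (by norm_num), hβ0.le, ?_⟩
  intro u B O L hu hB hO hL hosc hlip
  refine ⟨(1 - p ^ 2) * O + p ^ 2 * (L * ε), (ι⁻¹) ^ (s + n) * L + C' * O,
    add_nonneg (mul_nonneg (by linarith) hO) (by positivity), by positivity, ?_, ?_, ?_⟩
  · refine hosc.iterate_transOp_of_recurrent hS hSm hu hB hAm hp0.le hple ?_
    intro ξ hξ ξ' hξ' y hy y' hy' hyS hyS'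
    refine (hlip _ hyS _ hyS' (by simp)).trans (mul_le_mul_of_nonneg_left ?_ hL)
    refine (pastDist_le_of_close (a := w / 2) (n := n) hι (hD _ hyS _ hyS') (by positivity)
      fun j hj => ?_).trans ?_
    · have hidx : ∀ (ζ : ℕ → E) (z : Fin (s + n) → E),
          appendMany ζ z j = z (Fin.natAdd s ⟨n - 1 - j, by omega⟩) := fun ζ z => by
        rw [← appendMany_apply_lt ζ z]
        congr 1
        simp only [Fin.natAdd_mk]
        omega
      rw [hidx, hidx, ← dist_eq_norm]
      have h1 := Metric.mem_ball.1 (hy ⟨n - 1 - j, by omega⟩)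
      have h2 := Metric.mem_ball.1 (hy' ⟨n - 1 - j, by omega⟩)
      have h3 := dist_triangle_right (y (Fin.natAdd s ⟨n - 1 - j, by omega⟩))
        (y' (Fin.natAdd s ⟨n - 1 - j, by omega⟩)) (x ⟨n - 1 - j, by omega⟩)
      linarith
    · rw [← div_eq_mul_inv, div_le_iff₀ hr]
      linarith
  · have := LipLE.iterate_transOp hι hC0.le hS hD hC hu hB hO hL hosc hlip (s + n)
    rwa [Nat.zero_sub] at this
  · have h1 : (1 - p ^ 2 / 2) * O ≤ max (1 - p ^ 2 / 2) (3 / 4) * O :=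
      mul_le_mul_of_nonneg_right (le_max_left _ _) hO
    have h2 : 3 / 4 * (β * L) ≤ max (1 - p ^ 2 / 2) (3 / 4) * (β * L) :=
      mul_le_mul_of_nonneg_right (le_max_right _ _) (by positivity)
    have h3 : (ι⁻¹) ^ (s + n) * (β * L) ≤ 1 / 2 * (β * L) :=
      mul_le_mul_of_nonneg_right
        ((pow_le_pow_of_le_one hr0.le hr1.le (Nat.le_add_left n s)).trans hpow1) (by positivity)
    have h4 : p ^ 2 * ε = β / 4 := by rw [hβ, hε]; field_simp; norm_num
    have h5 : β * C' = p ^ 2 / 2 := by rw [hβ]; field_simp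
    calc (1 - p ^ 2) * O + p ^ 2 * (L * ε) + β * ((ι⁻¹) ^ (s + n) * L + C' * O)
        = (1 - p ^ 2) * O + (p ^ 2 * ε) * L + (ι⁻¹) ^ (s + n) * (β * L) + (β * C') * O := by ring
      _ = (1 - p ^ 2) * O + β / 4 * L + (ι⁻¹) ^ (s + n) * (β * L) + p ^ 2 / 2 * O := by
          rw [h4, h5]
      _ ≤ _ := by linarith

/-- The transition operator contracts the oscillation exponentially, at a rate that does not depend
on the observable, as soon as the latter depends on finitely many components. -/
theorem exists_exponential_oscLE [BorelSpace E] [SecondCountableTopology E] {ι C D : ℝ}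
    (hι : 1 < ι) (hC0 : 0 < C) (hS : IsAbsorbing Q S) (hSm : MeasurableSet S) (hne : S.Nonempty)
    (hD : ∀ ξ ∈ S, ∀ ξ' ∈ S, ∀ j, ‖ξ j - ξ' j‖ ≤ D)
    (hC : ∀ ξ ∈ S, ∀ ξ' ∈ S, tvDist (Q ξ) (Q ξ') ≤ C * pastDist ι ξ ξ') (hSR : HypSR S Q) :
    ∃ γ : ℝ, 0 < γ ∧ ∀ (m : ℕ) (u : (ℕ → E) → ℝ) (B : ℝ), Measurable u → (∀ ξ, |u ξ| ≤ B) →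
      (∀ ξ ξ', (∀ i < m, ξ i = ξ' i) → u ξ = u ξ') →
      ∃ M : ℝ, 0 ≤ M ∧ ∀ k : ℕ, OscLE S ((transOp Q)^[m + k] u) (M * Real.exp (-(γ * k))) := by
  obtain ⟨N, r, β, hN, hr0, hr1, hβ, hstep⟩ :=
    exists_lyapunov_contraction hι hC0 hS hSm hne hD hC hSR
  have hlog : Real.log r < 0 := Real.log_neg hr0 hr1
  have hN' : (0 : ℝ) < N := by exact_mod_cast hN
  refine ⟨-Real.log r / N, by apply div_pos <;> linarith, ?_⟩
  intro m u B hu hB hdep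
  have hB0 : 0 ≤ B := (abs_nonneg _).trans (hB fun _ => 0)
  have hosc : OscLE S u (2 * B) := fun ξ _ ξ' _ => by
    have h1 := abs_le.1 (hB ξ)
    have h2 := abs_le.1 (hB ξ')
    exact abs_le.2 ⟨by linarith, by linarith⟩
  -- Only pairs agreeing on the `m` most recent places are compared, so the constant is `0`; no
  -- continuity of `u` is needed. After `m` steps the restriction on pairs is gone.
  have hlip : LipLE ι S m u 0 := fun ξ _ ξ' _ h => by
    rw [hdep ξ ξ' h, sub_self, abs_zero, zero_mul]
  have hlip0 := LipLE.iterate_transOp hι hC0.le hS hD hC hu hB (by positivity) le_rfl hosc hlip m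
  have hosc0 := hosc.iterate_transOp hS hu hB m
  rw [Nat.sub_self, mul_zero, zero_add] at hlip0
  have hr' : 0 < 1 - ι⁻¹ := sub_pos.2 (inv_lt_one_of_one_lt₀ hι)
  set L₀ := C * (1 - ι⁻¹)⁻¹ * (2 * B) with hL₀
  have hL₀0 : 0 ≤ L₀ := by positivity
  set V := 2 * B + β * L₀ with hV
  have hV0 : 0 ≤ V := by positivity
  set v := (transOp Q)^[m] u with hv
  have hvm : Measurable v := measurable_iterate_transOp Q hu m
  have hvB : ∀ ξ, |v ξ| ≤ B := abs_iterate_transOp_le Q hB m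
  have hiter : ∀ j : ℕ, ∃ O L, 0 ≤ O ∧ 0 ≤ L ∧ OscLE S ((transOp Q)^[N * j] v) O ∧
      LipLE ι S 0 ((transOp Q)^[N * j] v) L ∧ O + β * L ≤ r ^ j * V := by
    intro j
    induction j with
    | zero => exact ⟨2 * B, L₀, by positivity, hL₀0, hosc0, hlip0, by simp [hV]⟩
    | succ j ih =>
      obtain ⟨O, L, hO, hL, h1, h2, h3⟩ := ih
      obtain ⟨O', L', hO', hL', h4, h5, h6⟩ := hstep _ B O L (measurable_iterate_transOp Q hvm _)
        (abs_iterate_transOp_le Q hvB _) hO hL h1 h2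
      rw [← Function.iterate_add_apply, Nat.add_comm N, ← Nat.mul_succ] at h4 h5
      refine ⟨O', L', hO', hL', h4, h5, h6.trans ?_⟩
      calc r * (O + β * L) ≤ r * (r ^ j * V) := mul_le_mul_of_nonneg_left h3 hr0.le
        _ = r ^ (j + 1) * V := by ring
  -- The factor `r⁻¹` pays for the last incomplete block of `k % N` steps, during which the
  -- oscillation merely does not grow.
  refine ⟨r⁻¹ * V, by positivity, fun k => ?_⟩
  obtain ⟨O, L, hO, hL, h1, -, h3⟩ := hiter (k / N)
  have h4 := h1.iterate_transOp hS (measurable_iterate_transOp Q hvm _)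
    (abs_iterate_transOp_le Q hvB _) (k % N)
  rw [← Function.iterate_add_apply, Nat.mod_add_div, hv, ← Function.iterate_add_apply,
    Nat.add_comm k m] at h4
  refine h4.mono ?_
  have h5 : O ≤ r ^ (k / N) * V := by
    have := mul_nonneg hβ hL
    linarith
  refine h5.trans ?_
  rw [mul_right_comm]
  refine mul_le_mul_of_nonneg_right ?_ hV0
  have h6 : (k : ℝ) / N - 1 ≤ ((k / N : ℕ) : ℝ) := by
    have h7 : (k : ℝ) ≤ N * ((k / N : ℕ) : ℝ) + N := by
      have h8 := Nat.div_add_mod k N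
      have h9 := (Nat.mod_lt k hN).le
      exact_mod_cast (by omega : k ≤ N * (k / N) + N)
    rw [sub_le_iff_le_add, div_le_iff₀ hN']
    linarith
  calc r ^ (k / N) = Real.exp (Real.log r * ((k / N : ℕ) : ℝ)) := by
        rw [mul_comm, Real.exp_nat_mul, Real.exp_log hr0]
    _ ≤ Real.exp (-Real.log r + -(-Real.log r / N * k)) := by
        refine Real.exp_le_exp.2 ?_
        have := mul_le_mul_of_nonpos_left h6 hlog.le
        refine this.trans_eq ?_
        field_simp
        ring
    _ = r⁻¹ * Real.exp (-(-Real.log r / N * k)) := by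
        rw [Real.exp_add, Real.exp_neg, Real.exp_log hr0]

end Contraction

/-! ### An absorbing set of full measure -/

section AbsorbingSet

variable {E : Type*} [MeasurableSpace E]

/-- Repeatedly discard the pasts from which the chain leaves the current set with positive
probability. Each pass discards a null set, and the intersection of all passes is absorbing because
countably many almost sure events hold together. -/
theorem exists_isAbsorbing_subset (Q : Kernel (ℕ → E) E) [IsMarkovKernel Q]
    {σ : Measure (ℕ → E)}
    (hσ : ∀ A : Set (ℕ → E), MeasurableSet A → (∀ᵐ ξ ∂σ, ξ ∈ A) →
      ∀ᵐ ξ ∂σ, ∀ᵐ y ∂Q ξ, append ξ y ∈ A)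
    {S₀ : Set (ℕ → E)} (hm : MeasurableSet S₀) (h₀ : ∀ᵐ ξ ∂σ, ξ ∈ S₀) :
    ∃ S ⊆ S₀, MeasurableSet S ∧ (∀ᵐ ξ ∂σ, ξ ∈ S) ∧ IsAbsorbing Q S := by
  set next : Set (ℕ → E) → Set (ℕ → E) := fun A => A ∩ {ξ | ∀ᵐ y ∂Q ξ, append ξ y ∈ A} with hnext
  have hprop : ∀ k, MeasurableSet (next^[k] S₀) ∧ ∀ᵐ ξ ∂σ, ξ ∈ next^[k] S₀ := by
    intro k
    induction k with
    | zero => exact ⟨hm, h₀⟩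
    | succ k ih =>
      obtain ⟨h1, h2⟩ := ih
      rw [Function.iterate_succ_apply']
      refine ⟨h1.inter ?_, ?_⟩
      · have := Kernel.measurable_kernel_prodMk_left (κ := Q) (measurable_append h1.compl)
        exact this (measurableSet_singleton 0)
      · filter_upwards [h2, hσ _ h1 h2] with ξ h3 h4 using ⟨h3, h4⟩
  refine ⟨⋂ k, next^[k] S₀, Set.iInter_subset (fun k => next^[k] S₀) 0,
    MeasurableSet.iInter fun k => (hprop k).1, ?_, ?_⟩
  · filter_upwards [ae_all_iff.2 fun k => (hprop k).2] with ξ hξ using Set.mem_iInter.2 hξ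
  · intro ξ hξ
    have h : ∀ k, ∀ᵐ y ∂Q ξ, append ξ y ∈ next^[k] S₀ := fun k => by
      have := Set.mem_iInter.1 hξ (k + 1)
      rw [Function.iterate_succ_apply'] at this
      exact this.2
    filter_upwards [ae_all_iff.2 h] with y hy using Set.mem_iInter.2 hy

end AbsorbingSet

/-! ### Stationarity and the Markov property of the pasts -/

section Stationarity

variable {Ω E : Type*}

/-- The past `{η_k, k ≤ l}` of the process at time `l`. -/
def pastAt (η : ℤ → Ω → E) (l : ℤ) (ω : Ω) : ℕ → E := fun j => η (l - j) ω

theorem append_pastAt (η : ℤ → Ω → E) (l : ℤ) (ω : Ω) :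
    append (pastAt η l ω) (η (l + 1) ω) = pastAt η (l + 1) ω := by
  funext j
  cases j with
  | zero => simp [append, pastAt]
  | succ j =>
    simp only [append, pastAt]
    congr 1
    push_cast
    ring

theorem window_eq_pastAt (η : ℤ → Ω → E) (k m : ℕ) (ω : Ω) :
    window η k m ω = fun i : Fin m => pastAt η ((k + m : ℕ) : ℤ) ω (m - 1 - i) := by
  funext i
  simp only [window, pastAt]
  congr 1
  omega

variable [MeasurableSpace Ω] [MeasurableSpace E] {P : Measure Ω} {η : ℤ → Ω → E}

theorem measurable_pastAt (hη : ∀ k, Measurable (η k)) (l : ℤ) : Measurable (pastAt η l) :=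
  measurable_pi_lambda _ fun _ => hη _

theorem IsStationary.map_pastAt_prod (hstat : IsStationary P η) (hη : ∀ k, Measurable (η k))
    (l : ℤ) : P.map (fun ω => (pastAt η l ω, η (l + 1) ω))
      = P.map (fun ω => (past η ω, η 1 ω)) := by
  have hF : Measurable (fun z : ℤ → E => ((fun j : ℕ => z (-(j : ℤ))), z 1)) :=
    (measurable_pi_lambda _ fun _ => measurable_pi_apply _).prodMk (measurable_pi_apply _)
  have h1 : Measurable (fun ω (k : ℤ) => η (k + l) ω) := measurable_pi_lambda _ fun _ => hη _
  have h2 : Measurable (fun ω (k : ℤ) => η k ω) := measurable_pi_lambda _ fun _ => hη _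
  have h := congrArg (Measure.map fun z : ℤ → E => ((fun j : ℕ => z (-(j : ℤ))), z 1)) (hstat l)
  rw [Measure.map_map hF h1, Measure.map_map hF h2] at h
  refine Eq.trans (congrArg (fun X => Measure.map X P) ?_) h
  funext ω
  refine Prod.ext (funext fun j => ?_) ?_
  · simp only [pastAt, Function.comp]
    congr 1
    ring
  · simp only [Function.comp]
    congr 1
    ring

theorem IsStationary.map_pastAt (hstat : IsStationary P η) (hη : ∀ k, Measurable (η k)) (l : ℤ) :
    P.map (pastAt η l) = pastLaw P η := by
  have h := congrArg (Measure.map Prod.fst) (hstat.map_pastAt_prod hη l)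
  have hp : Measurable (past η) := measurable_pi_lambda _ fun _ => hη _
  rwa [Measure.map_map measurable_fst ((measurable_pastAt hη l).prodMk (hη _)),
    Measure.map_map measurable_fst (hp.prodMk (hη _))] at h

variable [IsProbabilityMeasure P] {Q : Kernel (ℕ → E) E} [IsMarkovKernel Q]

theorem integral_mul_pastAt_succ (hη : ∀ k, Measurable (η k))
    (hQ : ∀ l : ℤ, P.map (fun ω => (pastAt η l ω, η (l + 1) ω)) = P.map (pastAt η l) ⊗ₘ Q)
    {Φ H : (ℕ → E) → ℝ} (hΦ : Measurable Φ) (hH : Measurable H) {a b : ℝ}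
    (ha : ∀ ξ, |Φ ξ| ≤ a) (hb : ∀ ξ, |H ξ| ≤ b) (l : ℤ) :
    ∫ ω, Φ (pastAt η l ω) * H (pastAt η (l + 1) ω) ∂P
      = ∫ ω, Φ (pastAt η l ω) * transOp Q H (pastAt η l ω) ∂P := by
  have hp := measurable_pastAt hη l
  have hF : Measurable (fun z : (ℕ → E) × E => Φ z.1 * H (append z.1 z.2)) :=
    (hΦ.comp measurable_fst).mul (hH.comp measurable_append)
  have hFb : ∀ z : (ℕ → E) × E, |Φ z.1 * H (append z.1 z.2)| ≤ a * b := fun z => by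
    rw [abs_mul]
    exact mul_le_mul (ha _) (hb _) (abs_nonneg _) ((abs_nonneg _).trans (ha z.1))
  have : IsProbabilityMeasure (P.map (pastAt η l)) := Measure.isProbabilityMeasure_map hp.aemeasurable
  calc ∫ ω, Φ (pastAt η l ω) * H (pastAt η (l + 1) ω) ∂P
      = ∫ z, Φ z.1 * H (append z.1 z.2) ∂(P.map fun ω => (pastAt η l ω, η (l + 1) ω)) := by
        rw [integral_map (hp.prodMk (hη _)).aemeasurable hF.aestronglyMeasurable]
        simp only [append_pastAt]
    _ = ∫ ξ, Φ ξ * transOp Q H ξ ∂(P.map (pastAt η l)) := by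
        rw [hQ l, Measure.integral_compProd (integrable_of_abs_le hF hFb)]
        simp only [integral_const_mul, transOp]
    _ = _ := integral_map hp.aemeasurable
        (hΦ.mul (measurable_transOp Q hH)).aestronglyMeasurable

theorem integral_mul_pastAt_add (hη : ∀ k, Measurable (η k))
    (hQ : ∀ l : ℤ, P.map (fun ω => (pastAt η l ω, η (l + 1) ω)) = P.map (pastAt η l) ⊗ₘ Q)
    {Φ H : (ℕ → E) → ℝ} (hΦ : Measurable Φ) (hH : Measurable H) {a b : ℝ}
    (ha : ∀ ξ, |Φ ξ| ≤ a) (hb : ∀ ξ, |H ξ| ≤ b) (l : ℤ) (j : ℕ) :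
    ∫ ω, Φ (pastAt η l ω) * H (pastAt η (l + j) ω) ∂P
      = ∫ ω, Φ (pastAt η l ω) * (transOp Q)^[j] H (pastAt η l ω) ∂P := by
  induction j generalizing H with
  | zero => simp
  | succ j ih =>
    -- Dropping the `j` most recent components recovers the past at time `l` from that at `l + j`,
    -- so `Φ` is a function of the later past and the one-step identity applies there.
    have hshift : Measurable (fun (ξ : ℕ → E) (i : ℕ) => ξ (i + j)) :=
      measurable_pi_lambda _ fun _ => measurable_pi_apply _
    have hpast : ∀ ω, (fun i : ℕ => pastAt η (l + j) ω (i + j)) = pastAt η l ω := fun ω => by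
      funext i
      simp only [pastAt]
      congr 1
      push_cast
      ring
    have h := integral_mul_pastAt_succ hη hQ (hΦ.comp hshift) hH (fun _ => ha _) hb (l + j)
    simp only [Function.comp, hpast] at h
    rw [Nat.cast_succ, ← add_assoc, h, ih (measurable_transOp Q hH) (abs_transOp_le Q hb)]
    rfl

/-- Bound for the covariance of a function and of a function with small oscillation. -/
theorem abs_integral_mul_sub_le {φ w : Ω → ℝ} (hφ : Measurable φ) (hw : Measurable w) {a b : ℝ}
    (ha : ∀ ω, |φ ω| ≤ a) (hb : ∀ ω, |w ω| ≤ b) {T : Set Ω} (hT : ∀ᵐ ω ∂P, ω ∈ T) {O : ℝ}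
    (hO : OscLE T w O) :
    |∫ ω, φ ω * w ω ∂P - (∫ ω, φ ω ∂P) * ∫ ω, w ω ∂P| ≤ a * O := by
  obtain ⟨c, hc⟩ := hO.exists_mem_Icc
  have hwi : Integrable w P := integrable_of_abs_le hw hb
  have hφi : Integrable φ P := integrable_of_abs_le hφ ha
  have hφw : Integrable (fun ω => φ ω * w ω) P :=
    hwi.bdd_mul hφ.aestronglyMeasurable (ae_of_all _ ha)
  have h1 : c ≤ ∫ ω, w ω ∂P := by
    have := integral_mono_ae (integrable_const c) hwi (hT.mono fun ω hω => (hc ω hω).1)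
    simpa using this
  have h2 : ∫ ω, w ω ∂P ≤ c + O := by
    have := integral_mono_ae hwi (integrable_const (c + O)) (hT.mono fun ω hω => (hc ω hω).2)
    simpa using this
  have heq : ∫ ω, φ ω * w ω ∂P - (∫ ω, φ ω ∂P) * ∫ ω, w ω ∂P
      = ∫ ω, φ ω * (w ω - ∫ ω, w ω ∂P) ∂P := by
    simp only [mul_sub]
    rw [integral_sub hφw (hφi.mul_const _), integral_mul_const]
  rw [heq]
  have := norm_integral_le_of_norm_le_const (μ := P)
    (f := fun ω => φ ω * (w ω - ∫ ω, w ω ∂P)) (C := a * O) (by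
      filter_upwards [hT] with ω hω
      rw [norm_mul]
      obtain ⟨h3, h4⟩ := hc ω hω
      exact mul_le_mul (ha ω) (abs_le.2 ⟨by linarith, by linarith⟩) (norm_nonneg _)
        ((abs_nonneg _).trans (ha ω)))
  simpa using this

end Stationarity

/-! ### From decay of oscillation to decay of correlations -/

section Main

variable {Ω E : Type*} [MeasurableSpace Ω]

theorem ExponentiallyFeeblyMixing.feeblyMixing [TopologicalSpace E] {P : Measure Ω}
    {η : ℤ → Ω → E} (h : ExponentiallyFeeblyMixing P η) : FeeblyMixing P η := by
  obtain ⟨γ, hγ, h⟩ := h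
  intro n m hn hm f g
  obtain ⟨C, hC⟩ := h n m hn hm f g
  have hlin : Tendsto (fun k : ℕ => γ * (k : ℝ)) atTop atTop :=
    tendsto_natCast_atTop_atTop.const_mul_atTop hγ
  have hexp : Tendsto (fun k : ℕ => C * Real.exp (-(γ * k))) atTop (𝓝 0) := by
    simpa using (Real.tendsto_exp_neg_atTop_nhds_zero.comp hlin).const_mul C
  have h0 : Tendsto (fun k => correlation P η f g k) atTop (𝓝 0) :=
    squeeze_zero_norm hC hexp
  exact tendsto_sub_nhds_zero_iff.1 h0

theorem exponentiallyFeeblyMixing_of_oscLE [TopologicalSpace E] [SecondCountableTopology E]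
    [MeasurableSpace E] [BorelSpace E] {P : Measure Ω} [IsProbabilityMeasure P]
    {η : ℤ → Ω → E} (hη : ∀ k, Measurable (η k)) {Q : Kernel (ℕ → E) E} [IsMarkovKernel Q]
    (hlaw : ∀ l : ℤ, P.map (pastAt η l) = pastLaw P η)
    (hQ : ∀ l : ℤ, P.map (fun ω => (pastAt η l ω, η (l + 1) ω)) = P.map (pastAt η l) ⊗ₘ Q)
    {S : Set (ℕ → E)} (hS : ∀ᵐ ξ ∂pastLaw P η, ξ ∈ S) {γ : ℝ} (hγ : 0 < γ)
    (hosc : ∀ (m : ℕ) (u : (ℕ → E) → ℝ) (B : ℝ), Measurable u → (∀ ξ, |u ξ| ≤ B) →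
      (∀ ξ ξ', (∀ i < m, ξ i = ξ' i) → u ξ = u ξ') →
      ∃ M : ℝ, 0 ≤ M ∧ ∀ k : ℕ, OscLE S ((transOp Q)^[m + k] u) (M * Real.exp (-(γ * k)))) :
    ExponentiallyFeeblyMixing P η := by
  refine ⟨γ, hγ, fun n m hn hm f g => ?_⟩
  have hrev : ∀ m : ℕ, Measurable (fun (ξ : ℕ → E) (i : Fin m) => ξ (m - 1 - i)) :=
    fun m => measurable_pi_lambda _ fun _ => measurable_pi_apply _
  set Φ : (ℕ → E) → ℝ := fun ξ => f fun i => ξ (n - 1 - i) with hΦ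
  set G : (ℕ → E) → ℝ := fun ξ => g fun i => ξ (m - 1 - i) with hG
  have hΦm : Measurable Φ := f.continuous.measurable.comp (hrev n)
  have hGm : Measurable G := g.continuous.measurable.comp (hrev m)
  have hΦb : ∀ ξ, |Φ ξ| ≤ ‖f‖ := fun ξ => f.norm_coe_le_norm _
  have hGb : ∀ ξ, |G ξ| ≤ ‖g‖ := fun ξ => g.norm_coe_le_norm _
  obtain ⟨M, hM, hosc⟩ := hosc m G ‖g‖ hGm hGb fun ξ ξ' h => by
    have : (fun i : Fin m => ξ (m - 1 - i)) = fun i : Fin m => ξ' (m - 1 - i) :=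
      funext fun i => h _ (by omega)
    simp only [hG, this]
  -- Conditioning on the past at time `n`, which determines `f`, leaves only `k - n` steps of decay;
  -- this costs `exp (γ * n)`. The second summand covers `k < n` by the trivial bound.
  refine ⟨(‖f‖ * M + 2 * (‖f‖ * ‖g‖)) * Real.exp (γ * n), fun k => ?_⟩
  have hexp : ∀ x : ℝ, x * Real.exp (γ * n) * Real.exp (-(γ * k))
      = x * Real.exp (γ * n - γ * k) := fun x => by
    rw [mul_assoc, ← Real.exp_add, sub_eq_add_neg]
  rw [hexp, add_mul]
  rcases le_or_gt n k with hnk | hnk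
  · have hp := measurable_pastAt hη n
    have hadd : ∀ Ψ : (ℕ → E) → ℝ, Measurable Ψ → ∀ a, (∀ ξ, |Ψ ξ| ≤ a) →
        ∫ ω, Ψ (pastAt η n ω) * G (pastAt η ((k + m : ℕ) : ℤ) ω) ∂P
          = ∫ ω, Ψ (pastAt η n ω) * (transOp Q)^[m + (k - n)] G (pastAt η n ω) ∂P := by
      intro Ψ hΨ a ha
      have := integral_mul_pastAt_add hη hQ hΨ hGm ha hGb n (m + (k - n))
      rwa [show (n : ℤ) + ((m + (k - n) : ℕ) : ℤ) = ((k + m : ℕ) : ℤ) by omega] at this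
    have hstatG : ∀ l : ℤ, ∫ ω, G (pastAt η l ω) ∂P = ∫ ξ, G ξ ∂pastLaw P η := fun l => by
      rw [← hlaw l, integral_map (measurable_pastAt hη l).aemeasurable hGm.aestronglyMeasurable]
    have h1 := hadd Φ hΦm _ hΦb
    have h2 := hadd (fun _ => 1) measurable_const 1 (by simp)
    simp only [one_mul] at h2
    have hcorr : correlation P η f g k
        = ∫ ω, Φ (pastAt η n ω) * (transOp Q)^[m + (k - n)] G (pastAt η n ω) ∂P
          - (∫ ω, Φ (pastAt η n ω) ∂P)
            * ∫ ω, (transOp Q)^[m + (k - n)] G (pastAt η n ω) ∂P := by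
      rw [← h1, ← h2, hstatG, ← hstatG ((0 + m : ℕ) : ℤ), correlation]
      simp only [window_eq_pastAt, hΦ, hG, zero_add]
    rw [hcorr]
    have hT : ∀ᵐ ω ∂P, ω ∈ pastAt η n ⁻¹' S := by
      rw [← hlaw n] at hS
      exact ae_of_ae_map hp.aemeasurable hS
    refine (abs_integral_mul_sub_le (hΦm.comp hp)
      ((measurable_iterate_transOp Q hGm _).comp hp) (fun _ => hΦb _)
      (fun _ => abs_iterate_transOp_le Q hGb _ _) hT
      (fun ω hω ω' hω' => hosc (k - n) _ hω _ hω')).trans ?_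
    have hcast : -(γ * ((k - n : ℕ) : ℝ)) = γ * n - γ * k := by
      rw [Nat.cast_sub hnk]
      ring
    rw [hcast, ← mul_assoc]
    exact le_add_of_nonneg_right (by positivity)
  · have hfb : ∀ ω, |f (window η 0 n ω)| ≤ ‖f‖ := fun _ => f.norm_coe_le_norm _
    have hgb : ∀ k ω, |g (window η k m ω)| ≤ ‖g‖ := fun _ _ => g.norm_coe_le_norm _
    have h1 : |∫ ω, f (window η 0 n ω) * g (window η k m ω) ∂P| ≤ ‖f‖ * ‖g‖ :=
      abs_integral_le_of_abs_le fun ω => by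
        rw [abs_mul]
        exact mul_le_mul (hfb ω) (hgb k ω) (abs_nonneg _) (norm_nonneg _)
    have h2 : |(∫ ω, f (window η 0 n ω) ∂P) * ∫ ω, g (window η 0 m ω) ∂P| ≤ ‖f‖ * ‖g‖ := by
      rw [abs_mul]
      exact mul_le_mul (abs_integral_le_of_abs_le hfb) (abs_integral_le_of_abs_le (hgb 0))
        (abs_nonneg _) (norm_nonneg _)
    have h3 : |correlation P η f g k| ≤ 2 * (‖f‖ * ‖g‖) := by
      refine (abs_sub _ _).trans ?_
      linarith
    have h4 : 1 ≤ Real.exp (γ * n - γ * k) := by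
      refine Real.one_le_exp ?_
      rw [← mul_sub]
      exact mul_nonneg hγ.le (sub_nonneg.2 (by exact_mod_cast hnk.le))
    have h5 : 2 * (‖f‖ * ‖g‖) ≤ 2 * (‖f‖ * ‖g‖) * Real.exp (γ * n - γ * k) :=
      le_mul_of_one_le_right (by positivity) h4
    refine h3.trans (h5.trans (le_add_of_nonneg_left (by positivity)))

end Main

end FeebleMixing

theorem proposition4p4
    {Ω E : Type*} [MeasurableSpace Ω]
    [NormedAddCommGroup E] [NormedSpace ℝ E] [CompleteSpace E] [SecondCountableTopology E]
    [MeasurableSpace E] [BorelSpace E]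
    (P : Measure Ω) [IsProbabilityMeasure P]
    (η : ℤ → Ω → E) (hη : ∀ k, Measurable (η k))
    (hstat : FeebleMixing.IsStationary P η)
    (hK : IsCompact (P.map (η 0)).support)
    (ι : ℝ) (hι : 1 < ι)
    (Q : Kernel (ℕ → E) E) [IsMarkovKernel Q]
    (hQ : Q =ᵐ[FeebleMixing.pastLaw P η] condDistrib (η 1) (FeebleMixing.past η) P)
    (hSF : FeebleMixing.HypSF ι (P.map (η 0)).support (FeebleMixing.pastLaw P η).support Q)
    (hDLP : FeebleMixing.HypDLP ι (FeebleMixing.pastLaw P η).support Q)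
    (hSR : FeebleMixing.HypSR (FeebleMixing.pastLaw P η).support Q) :
    FeebleMixing.FeeblyMixing P η ∧ FeebleMixing.ExponentiallyFeeblyMixing P η := by
  have hp : Measurable (FeebleMixing.past η) := measurable_pi_lambda _ fun _ => hη _
  have hprob : IsProbabilityMeasure (FeebleMixing.pastLaw P η) :=
    Measure.isProbabilityMeasure_map hp.aemeasurable
  have hlaw := hstat.map_pastAt hη
  have hjoint : ∀ l : ℤ, P.map (fun ω => (FeebleMixing.pastAt η l ω, η (l + 1) ω))
      = P.map (FeebleMixing.pastAt η l) ⊗ₘ Q := fun l => by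
    rw [hstat.map_pastAt_prod hη l, hlaw l, Measure.compProd_congr hQ, FeebleMixing.pastLaw,
      compProd_map_condDistrib (hη 1).aemeasurable]
  have hinv : ∀ A : Set (ℕ → E), MeasurableSet A →
      (∀ᵐ ξ ∂FeebleMixing.pastLaw P η, ξ ∈ A) →
      ∀ᵐ ξ ∂FeebleMixing.pastLaw P η, ∀ᵐ y ∂Q ξ, FeebleMixing.append ξ y ∈ A := by
    intro A hA hAe
    have hpair := (FeebleMixing.measurable_pastAt hη 0).prodMk (hη (0 + 1))
    have h := hjoint 0
    rw [hlaw 0] at h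
    refine (Measure.ae_compProd_iff (FeebleMixing.measurable_append hA)).1 ?_
    rw [← h, ae_map_iff hpair.aemeasurable (FeebleMixing.measurable_append hA)]
    simp only [FeebleMixing.append_pastAt]
    rw [← hlaw (0 + 1)] at hAe
    exact ae_of_ae_map (FeebleMixing.measurable_pastAt hη _).aemeasurable hAe
  set K := (P.map (η 0)).support with hKdef
  -- Confining all components to the compact `K` gives the uniform bound `D` on their differences,
  -- hence convergence of the series `pastDist`.
  have hKae : ∀ᵐ ξ ∂FeebleMixing.pastLaw P η, ∀ j, ξ j ∈ K := by
    refine ae_all_iff.2 fun j => ?_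
    rw [← hlaw j]
    refine (ae_map_iff (FeebleMixing.measurable_pastAt hη _).aemeasurable
      (measurable_pi_apply j hK.measurableSet)).2 ?_
    have : ∀ᵐ x ∂P.map (η 0), x ∈ K := Measure.support_mem_ae
    refine (ae_of_ae_map (hη 0).aemeasurable this).mono fun ω hω => ?_
    simpa [FeebleMixing.pastAt] using hω
  have hsupp : ∀ᵐ ξ ∂FeebleMixing.pastLaw P η, ξ ∈ (FeebleMixing.pastLaw P η).support :=
    Measure.support_mem_ae
  have hSKm : MeasurableSet ((FeebleMixing.pastLaw P η).support ∩ {ξ | ∀ j, ξ j ∈ K}) := by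
    refine Measure.isClosed_support.measurableSet.inter ?_
    rw [Set.ofPred_forall]
    exact MeasurableSet.iInter fun j => measurable_pi_apply j hK.measurableSet
  obtain ⟨S, hSsub, hSm, hSae, hSabs⟩ := FeebleMixing.exists_isAbsorbing_subset Q hinv hSKm
    (by filter_upwards [hsupp, hKae] with ξ h1 h2 using ⟨h1, h2⟩)
  obtain ⟨D, hD⟩ := Metric.isBounded_iff.1 hK.isBounded
  obtain ⟨C, hC0, hC⟩ := hSF.lipschitz
  have hSR' : FeebleMixing.HypSR S Q := fun n hn δ hδ => by
    obtain ⟨x, s, h⟩ := hSR n hn δ hδ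
    exact ⟨x, s, h.trans_le (biInf_mono fun ξ hξ => (hSsub hξ).1)⟩
  obtain ⟨γ, hγ, hosc⟩ := FeebleMixing.exists_exponential_oscLE hι hC0 hSabs hSm
    hSae.exists (fun ξ hξ ξ' hξ' j => by
      rw [← dist_eq_norm]
      exact hD ((hSsub hξ).2 j) ((hSsub hξ').2 j))
    (fun ξ hξ ξ' hξ' => hC ξ (hSsub hξ).1 ξ' (hSsub hξ').1) hSR'
  have hmix := FeebleMixing.exponentiallyFeeblyMixing_of_oscLE hη hlaw hjoint hSae hγ hosc
  exact ⟨hmix.feeblyMixing, hmix⟩
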